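/- Let $\mathcal{A}$ be an abelian category (not assumed to have enough projectives or enough injectives), let $\mathrm{Ext}^i_{\mathcal A}$ denote its (Yoneda) Ext groups, and let $\mathrm{Proj}(\mathcal{A})$ be the class of projective objects. For classes of objects $\mathcal{X},\mathcal{Y}$ of $\mathcal{A}$ we use the following notation. - $\mathcal{X}\perp\mathcal{Y}$ means $\mathrm{Ext}^i_{\mathcal A}(X,Y)=0$ for all $X\in\mathcal{X}$, $Y\in\mathcal{Y}$, $i>0$. Further $\mathcal{X}^{\perp_1}=\{N:\mathrm{Ext}^1_{\mathcal A}(X,N)=0\ \forall X\in\mathcal{X}\}$ and ${}^{\perp_1}\mathcal{Y}=\{M:\mathrm{Ext}^1_{\mathcal A}(M,Y)=0\ \forall Y\in\mathcal{Y}\}$. - $\mathrm{resdim}_{\mathcal X}(M)\in\mathbb{N}\cup\{\infty\}$ is the least $n\ge 0$ for which there is an exact sequence $0\to X_n\to\cdots\to X_1\to X_0\to M\to 0$ with all $X_i\in\mathcal{X}$ ($\infty$ if there is none), and $\mathcal{X}^{\wedge}_n$ is the class of objects $M$ with $\mathrm{resdim}_{\mathcal X}(M)\le n$. - $\mathcal{GP}_{(\mathcal{X},\mathcal{Y})}$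 is the class of $(\mathcal{X},\mathcal{Y})$-Gorenstein projective objects: those isomorphic to a cycle of an exact complex $X_\bullet=(X_m)_{m\in\mathbb{Z}}$ with all $X_m\in\mathcal{X}$ such that the complex $\mathrm{Hom}_{\mathcal A}(X_\bullet,Y)$ is exact for every $Y\in\mathcal{Y}$. - $\mathrm{gl.GPD}_{(\mathcal{X},\mathcal{Y})}(\mathcal{A})=\sup_{M\in\mathcal{A}}\mathrm{resdim}_{\mathcal{GP}_{(\mathcal{X},\mathcal{Y})}}(M)$. - The pair $(\mathcal{X},\mathcal{Y})$ is GP-admissible if: every $A\in\mathcal{A}$ admits an epimorphism $X\to A$ with $X\in\mathcal{X}$; $\mathcal{X}$ and $\mathcal{Y}$ are closed under finite coproducts and $\mathcal{X}$ is closed under extensions; for every $X\in\mathcal{X}$ there is a short exact sequence $0\to X\to W\to X'\to 0$ with $W\in\mathcal{X}\cap\mathcal{Y}$ and $X'\in\mathcal{X}$; and $\mathcal{X}\perp\mathcal{Y}$. - The pair $(\mathcal{X},\mathcal{Y})$ is a cotorsion pair if $\mathcal{X}^{\perp_1}=\mathcal{Y}$ and $\mathcal{X}={}^{\perp_1}\mathcal{Y}$.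 It is hereditary if moreover $\mathcal{X}\perp\mathcal{Y}$, and complete if for every $A\in\mathcal{A}$ there are exact sequences $0\to Y\to X\to A\to 0$ and $0\to A\to Y'\to X'\to 0$ with $X,X'\in\mathcal{X}$ and $Y,Y'\in\mathcal{Y}$. **Proposition.** Let $(\mathcal{X},\mathcal{Y})$ be a GP-admissible pair in $\mathcal{A}$ with $\mathcal{X}\cap\mathcal{Y}=\mathrm{Proj}(\mathcal{A})$, and let $n\ge 0$ be an integer. If $\mathrm{gl.GPD}_{(\mathcal{X},\mathcal{Y})}(\mathcal{A})\le n$, then $(\mathcal{GP}_{(\mathcal{X},\mathcal{Y})},\mathrm{Proj}(\mathcal{A})^{\wedge}_n)$ is a hereditary and complete cotorsion pair in $\mathcal{A}$. -/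

import Mathlib

open CategoryTheory CategoryTheory.Limits

universe w v u

namespace RelGor

variable {C : Type u} [Category.{v} C] [Abelian C]

section Ext

variable [HasExt.{w} C]

/-- `𝒳 ⊥ 𝒴`: `Ext^i(X, Y) = 0` for all `X ∈ 𝒳`, `Y ∈ 𝒴` and `i > 0`. Here `Ext` is defined for
every abelian category (no enough projectives or injectives needed). The instance `HasExt.{w} C`
only selects a universe `w` in which all Ext-groups fit; one always exists
(`HasExt.standard`). -/
def ExtOrthogonal (𝒳 𝒴 : ObjectProperty C) : Prop :=
  ∀ ⦃X Y : C⦄, 𝒳 X → 𝒴 Y → ∀ i : ℕ, 0 < i → Subsingleton (Abelian.Ext.{w} X Y i)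

/-- `𝒳^{⊥₁} = {N | Ext¹(X, N) = 0 for all X ∈ 𝒳}`. -/
def rightPerpOne (𝒳 : ObjectProperty C) : ObjectProperty C :=
  fun N => ∀ ⦃X : C⦄, 𝒳 X → Subsingleton (Abelian.Ext.{w} X N 1)

/-- `^{⊥₁}𝒴 = {M | Ext¹(M, Y) = 0 for all Y ∈ 𝒴}`. -/
def leftPerpOne (𝒴 : ObjectProperty C) : ObjectProperty C :=
  fun M => ∀ ⦃Y : C⦄, 𝒴 Y → Subsingleton (Abelian.Ext.{w} M Y 1)

end Ext

/-- There is an exact sequence `0 → X_n → ⋯ → X_1 → X_0 → M → 0` with all `X_i ∈ 𝒳`.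
The sequence is an exact chain complex `K` with `M` in degree `0`, `X_i` in degree `i + 1`
and zero in the degrees above `n + 1`. -/
def HasFiniteResolution (𝒳 : ObjectProperty C) (M : C) (n : ℕ) : Prop :=
  ∃ K : ChainComplex C ℕ, K.Acyclic ∧ Nonempty (K.X 0 ≅ M) ∧
    (∀ i : ℕ, i ≤ n → 𝒳 (K.X (i + 1))) ∧ ∀ i : ℕ, n + 1 < i → IsZero (K.X i)

/-- The `𝒳`-resolution dimension of `M`: the least length of a finite `𝒳`-resolution, and `∞`
(`⊤`) if there is none. -/
noncomputable def resdim (𝒳 : ObjectProperty C) (M : C) : ℕ∞ :=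
  ⨅ (n : ℕ) (_ : HasFiniteResolution 𝒳 M n), (n : ℕ∞)

/-- `𝒳^∧_n`: the objects of `𝒳`-resolution dimension at most `n`. -/
def resdimLE (𝒳 : ObjectProperty C) (n : ℕ) : ObjectProperty C :=
  fun M => resdim 𝒳 M ≤ n

/-- For every `Y ∈ 𝒴`, the complex `Hom(K, Y)` of abelian groups is exact. -/
def HomExact (𝒴 : ObjectProperty C) (K : CochainComplex C ℤ) : Prop :=
  ∀ ⦃Y : C⦄, 𝒴 Y → ∀ m : ℤ,
    Function.Exact (fun f : K.X (m + 1 + 1) ⟶ Y => K.d (m + 1) (m + 1 + 1) ≫ f)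
      (fun f : K.X (m + 1) ⟶ Y => K.d m (m + 1) ≫ f)

/-- `M` is `(𝒳, 𝒴)`-Gorenstein projective: it is a cycle of an exact complex with terms in `𝒳`
that stays exact under `Hom(-, Y)` for every `Y ∈ 𝒴`. -/
def GP (𝒳 𝒴 : ObjectProperty C) : ObjectProperty C := fun M =>
  ∃ K : CochainComplex C ℤ, K.Acyclic ∧ (∀ m : ℤ, 𝒳 (K.X m)) ∧ HomExact 𝒴 K ∧
    ∃ m : ℤ, Nonempty (K.cycles m ≅ M)

/-- The `(𝒳, 𝒴)`-Gorenstein projective dimension of `M`. -/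
noncomputable def Gpd (𝒳 𝒴 : ObjectProperty C) (M : C) : ℕ∞ := resdim (GP 𝒳 𝒴) M

/-- The global `(𝒳, 𝒴)`-Gorenstein projective dimension of the category. -/
noncomputable def glGPD (𝒳 𝒴 : ObjectProperty C) : ℕ∞ := ⨆ M : C, Gpd 𝒳 𝒴 M

/-- `(𝒳, 𝒴)` is GP-admissible. -/
structure IsGPAdmissible [HasExt.{w} C] (𝒳 𝒴 : ObjectProperty C) : Prop where
  /-- every object is a quotient of an object of `𝒳` -/
  exists_epi : ∀ A : C, ∃ (X : C) (f : X ⟶ A), 𝒳 X ∧ Epi f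
  left_coproducts : 𝒳.IsClosedUnderFiniteCoproducts
  right_coproducts : 𝒴.IsClosedUnderFiniteCoproducts
  left_extensions : 𝒳.IsClosedUnderExtensions
  /-- `𝒳 ∩ 𝒴` is a relative cogenerator in `𝒳` -/
  exists_cogenerator : ∀ X : C, 𝒳 X → ∃ (W X' : C) (f : X ⟶ W) (g : W ⟶ X') (h : f ≫ g = 0),
    (ShortComplex.mk f g h).ShortExact ∧ (𝒳 W ∧ 𝒴 W) ∧ 𝒳 X'
  orthogonal : ExtOrthogonal.{w} 𝒳 𝒴

/-- `(𝒳, 𝒴)` is a cotorsion pair. -/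
structure IsCotorsionPair [HasExt.{w} C] (𝒳 𝒴 : ObjectProperty C) : Prop where
  right_eq : rightPerpOne.{w} 𝒳 = 𝒴
  left_eq : 𝒳 = leftPerpOne.{w} 𝒴

/-- `(𝒳, 𝒴)` is complete: every `A` admits exact sequences `0 → Y → X → A → 0` and
`0 → A → Y' → X' → 0` with `X, X' ∈ 𝒳` and `Y, Y' ∈ 𝒴`. -/
structure IsCompletePair (𝒳 𝒴 : ObjectProperty C) : Prop where
  left_approx : ∀ A : C, ∃ (Y X : C) (f : Y ⟶ X) (g : X ⟶ A) (h : f ≫ g = 0),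
    (ShortComplex.mk f g h).ShortExact ∧ 𝒴 Y ∧ 𝒳 X
  right_approx : ∀ A : C, ∃ (Y X : C) (f : A ⟶ Y) (g : Y ⟶ X) (h : f ≫ g = 0),
    (ShortComplex.mk f g h).ShortExact ∧ 𝒴 Y ∧ 𝒳 X

end RelGor

/-! Projectives lie in `𝒴`, so `Ext^i` from Gorenstein projectives to them vanishes for `i > 0`;
dimension shifting extends this to `Proj^∧_n`. The approximation sequences come by induction on the
length of a Gorenstein projective resolution (`exists_approximations`), from pushouts and from
embeddings of Gorenstein projectives into projectives with Gorenstein projective cokernel. If `N` is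
right orthogonal to `GP`, its approximation `0 → N → Y → X → 0` splits; if `M` is left orthogonal to
`Proj^∧_n`, then `0 → Y → X → M → 0` splits. Both equalities of the cotorsion pair thus reduce to
closure under direct summands (`HasFiniteResolution.of_retract`, `gp_of_biprod`).

The closure properties of `GP` are proved coinductively. The left half of a complete resolution
costs nothing: every object is a quotient of one in `𝒳`, and the kernels stay in `^⊥𝒴`. Hence `GP`
is the largest class inside `^⊥𝒴` whose members embed in objects of `𝒳` with cokernel in the class
(`gp_of_maxCoresolving`, `isCoresolving_gp`), and it is enough to exhibit such a class containing
the given object. -/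

namespace RelGor

variable {C : Type u} [Category.{v} C] [Abelian C]

/-! ### Pushouts and cokernels of short exact sequences -/

section ShortExact

/-- There is a short exact sequence `0 → A → B → D → 0`. -/
def HasShortExact (A B D : C) : Prop :=
  ∃ (f : A ⟶ B) (g : B ⟶ D) (h : f ≫ g = 0), (ShortComplex.mk f g h).ShortExact

/-- Suited to pushouts, where maps out are easy to build: `g` is a cokernel of `f`, with uniqueness
of the factorization free because `g` is epi. -/
lemma ShortExact.mk_of_exists_desc {A B D : C} (f : A ⟶ B) (g : B ⟶ D) (h : f ≫ g = 0)
    [Mono f] [Epi g] (hg : ∀ {T : C} (k : B ⟶ T), f ≫ k = 0 → ∃ l : D ⟶ T, g ≫ l = k) :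
    (ShortComplex.mk f g h).ShortExact where
  exact := ShortComplex.exact_of_g_is_cokernel _
    (CokernelCofork.IsColimit.ofπ g h (fun k hk => (hg k hk).choose)
      (fun k hk => (hg k hk).choose_spec)
      (fun k hk m hm => by rw [← cancel_epi g, hm, (hg k hk).choose_spec]))

lemma ShortExact.exists_desc {A B D T : C} {f : A ⟶ B} {g : B ⟶ D} {h : f ≫ g = 0}
    (hS : (ShortComplex.mk f g h).ShortExact) (k : B ⟶ T) (hk : f ≫ k = 0) :
    ∃ l : D ⟶ T, g ≫ l = k := by
  have : Epi (ShortComplex.mk f g h).g := hS.epi_g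
  exact ⟨hS.exact.desc k hk, hS.exact.g_desc k hk⟩

lemma ShortExact.exists_lift {A B D T : C} {f : A ⟶ B} {g : B ⟶ D} {h : f ≫ g = 0}
    (hS : (ShortComplex.mk f g h).ShortExact) (k : T ⟶ B) (hk : k ≫ g = 0) :
    ∃ l : T ⟶ A, l ≫ f = k := by
  have : Mono (ShortComplex.mk f g h).f := hS.mono_f
  exact ⟨hS.exact.lift k hk, hS.exact.lift_f k hk⟩

lemma shortExact_kernel {X M : C} (p : X ⟶ M) [Epi p] :
    (ShortComplex.mk (kernel.ι p) p (kernel.condition p)).ShortExact where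
  exact := ShortComplex.exact_kernel p

lemma HasShortExact.of_iso {A A' B B' D D' : C} (h : HasShortExact A B D)
    (a : A ≅ A') (b : B ≅ B') (d : D ≅ D') : HasShortExact A' B' D' := by
  obtain ⟨f, g, w, hS⟩ := h
  exact ⟨a.inv ≫ f ≫ b.hom, b.inv ≫ g ≫ d.hom, by simp [reassoc_of% w],
    ShortComplex.shortExact_of_iso (ShortComplex.isoMk a b d (by simp) (by simp)) hS⟩

lemma hasShortExact_biprod (A B : C) : HasShortExact A (A ⊞ B) B :=
  ⟨biprod.inl, biprod.snd, by simp, (ShortComplex.Splitting.ofHasBinaryBiproduct A B).shortExact⟩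

lemma hasShortExact_zero (A Z : C) (hZ : IsZero Z) : HasShortExact Z A A := by
  have : Mono (0 : Z ⟶ A) := ⟨fun _ _ _ => hZ.eq_of_tgt _ _⟩
  exact ⟨0, 𝟙 A, by simp, ShortExact.mk_of_exists_desc _ _ _ fun k _ => ⟨k, by simp⟩⟩

/-- Pushout of two short exact sequences with the same left end. -/
lemma HasShortExact.exists_pushout {A B D X E : C} (h : HasShortExact A B D)
    (h' : HasShortExact A X E) : ∃ Q, HasShortExact X Q D ∧ HasShortExact B Q E := by
  suffices key : ∀ {A B D X : C} (f : A ⟶ B) (g : B ⟶ D) (w : f ≫ g = 0) (i : A ⟶ X) [Mono i],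
      (ShortComplex.mk f g w).ShortExact →
      ∃ (q : pushout f i ⟶ D) (w' : pushout.inr f i ≫ q = 0),
      (ShortComplex.mk (pushout.inr f i) q w').ShortExact by
    obtain ⟨f, g, w, hS⟩ := h
    obtain ⟨i, p, w', hS'⟩ := h'
    have : Mono i := hS'.mono_f
    have : Mono f := hS.mono_f
    obtain ⟨q, wq, hq⟩ := key f g w i hS
    obtain ⟨q', wq', hq'⟩ := key i p w' f hS'
    exact ⟨pushout f i, ⟨_, _, wq, hq⟩,
      HasShortExact.of_iso ⟨_, _, wq', hq'⟩ (Iso.refl _) (pushoutSymmetry _ _) (Iso.refl _)⟩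
  intro A B D X f g w i _ hS
  have : Mono f := hS.mono_f
  have : Epi g := hS.epi_g
  refine ⟨pushout.desc g 0 (by simp [w]), pushout.inr_desc _ _ _, ?_⟩
  have : Epi (pushout.desc g 0 (by simp [w]) : pushout f i ⟶ D) :=
    epi_of_epi_fac (pushout.inl_desc g 0 _)
  refine ShortExact.mk_of_exists_desc _ _ _ fun k hk => ?_
  obtain ⟨l, hl⟩ := ShortExact.exists_desc hS (pushout.inl f i ≫ k)
    (by rw [pushout.condition_assoc, hk, comp_zero])
  refine ⟨l, pushout.hom_ext ?_ ?_⟩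
  · rw [pushout.inl_desc_assoc, hl]
  · rw [pushout.inr_desc_assoc, hk, zero_comp]

/-- The cokernel of a composition of monomorphisms is an extension of the cokernels. -/
lemma HasShortExact.exists_cokernel_comp {A B D W E : C} (h : HasShortExact A B D)
    (h' : HasShortExact B W E) : ∃ Q, HasShortExact A W Q ∧ HasShortExact D Q E := by
  obtain ⟨f, g, w, hS⟩ := h
  obtain ⟨j, p, w', hS'⟩ := h'
  have : Mono f := hS.mono_f
  have : Epi g := hS.epi_g
  have : Mono j := hS'.mono_f
  have : Epi p := hS'.epi_g
  -- The quotient `W / A` is realized as the pushout of `B → D` and `B → W`.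
  refine ⟨pushout g j, ⟨f ≫ j, pushout.inr g j, ?_, ?_⟩,
    pushout.inl g j, pushout.desc 0 p (by simp [w']), pushout.inl_desc _ _ _, ?_⟩
  · rw [Category.assoc, ← pushout.condition, reassoc_of% w, zero_comp]
  · refine ShortExact.mk_of_exists_desc _ _ _ fun k hk => ?_
    obtain ⟨l, hl⟩ := ShortExact.exists_desc hS (j ≫ k) (by simpa using hk)
    exact ⟨pushout.desc l k hl, pushout.inr_desc _ _ _⟩
  · have : Epi (pushout.desc 0 p (by simp [w']) : pushout g j ⟶ E) :=
      epi_of_epi_fac (pushout.inr_desc 0 p _)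
    refine ShortExact.mk_of_exists_desc _ _ _ fun k hk => ?_
    obtain ⟨l, hl⟩ := ShortExact.exists_desc hS' (pushout.inr g j ≫ k)
      (by rw [← pushout.condition_assoc, hk, comp_zero])
    refine ⟨l, pushout.hom_ext ?_ ?_⟩
    · rw [pushout.inl_desc_assoc, hk, zero_comp]
    · rw [pushout.inr_desc_assoc, hl]

lemma HasShortExact.biprod_left {A B D : C} (h : HasShortExact A B D) (M : C) :
    HasShortExact (M ⊞ A) (M ⊞ B) D := by
  obtain ⟨f, g, w, hS⟩ := h
  have : Mono f := hS.mono_f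
  have : Epi g := hS.epi_g
  have : Epi (biprod.snd ≫ g : M ⊞ B ⟶ D) := epi_comp _ _
  refine ⟨biprod.map (𝟙 M) f, biprod.snd ≫ g, by simp [w], ?_⟩
  refine ShortExact.mk_of_exists_desc _ _ _ fun k hk => ?_
  have h1 : biprod.inl ≫ k = 0 := by simpa using biprod.inl ≫= hk
  obtain ⟨l, hl⟩ := ShortExact.exists_desc hS (biprod.inr ≫ k)
    (by simpa using biprod.inr ≫= hk)
  exact ⟨l, by ext <;> simp [hl, h1]⟩

end ShortExact

/-! ### Vanishing of Ext along short exact sequences -/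

section ExtVanishing

variable [HasExt.{w} C]

/-- `Extⁱ(M, Y) = 0` for all `i > 0`. -/
def ExtAcyclic (M Y : C) : Prop := ∀ i : ℕ, 0 < i → Subsingleton (Abelian.Ext.{w} M Y i)

lemma HasShortExact.subsingleton_ext_middle {A B D : C} (h : HasShortExact A B D) {Y : C} {i : ℕ}
    (h₁ : Subsingleton (Abelian.Ext.{w} A Y i)) (h₃ : Subsingleton (Abelian.Ext.{w} D Y i)) :
    Subsingleton (Abelian.Ext.{w} B Y i) := by
  obtain ⟨f, g, w, hS⟩ := h
  refine subsingleton_of_forall_eq 0 fun x => ?_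
  obtain ⟨y, rfl⟩ := Abelian.Ext.contravariant_sequence_exact₂ hS Y x (Subsingleton.elim _ _)
  rw [Subsingleton.elim y 0, Abelian.Ext.comp_zero]

lemma HasShortExact.subsingleton_ext_left {A B D : C} (h : HasShortExact A B D) {Y : C} {i : ℕ}
    (h₂ : Subsingleton (Abelian.Ext.{w} B Y i)) (h₃ : Subsingleton (Abelian.Ext.{w} D Y (i + 1))) :
    Subsingleton (Abelian.Ext.{w} A Y i) := by
  obtain ⟨f, g, w, hS⟩ := h
  refine subsingleton_of_forall_eq 0 fun x => ?_
  obtain ⟨y, rfl⟩ := Abelian.Ext.contravariant_sequence_exact₁ hS Y x (add_comm 1 i)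
    (Subsingleton.elim _ _)
  rw [Subsingleton.elim y 0, Abelian.Ext.comp_zero]

lemma HasShortExact.subsingleton_ext_right {A B D : C} (h : HasShortExact A B D) {Y : C} {i : ℕ}
    (h₁ : Subsingleton (Abelian.Ext.{w} A Y i)) (h₂ : Subsingleton (Abelian.Ext.{w} B Y (i + 1))) :
    Subsingleton (Abelian.Ext.{w} D Y (i + 1)) := by
  obtain ⟨f, g, w, hS⟩ := h
  refine subsingleton_of_forall_eq 0 fun x => ?_
  obtain ⟨y, rfl⟩ := Abelian.Ext.contravariant_sequence_exact₃ hS Y x (Subsingleton.elim _ _)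
    (add_comm 1 i)
  rw [Subsingleton.elim y 0, Abelian.Ext.comp_zero]

lemma HasShortExact.subsingleton_ext_target {A B D : C} (h : HasShortExact A B D) {X : C} {i : ℕ}
    (h₂ : Subsingleton (Abelian.Ext.{w} X B i)) (h₁ : Subsingleton (Abelian.Ext.{w} X A (i + 1))) :
    Subsingleton (Abelian.Ext.{w} X D i) := by
  obtain ⟨f, g, w, hS⟩ := h
  refine subsingleton_of_forall_eq 0 fun x => ?_
  obtain ⟨y, rfl⟩ := Abelian.Ext.covariant_sequence_exact₃ X hS x rfl (Subsingleton.elim _ _)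
  rw [Subsingleton.elim y 0, Abelian.Ext.zero_comp]

lemma ExtAcyclic.middle {A B D Y : C} (h : HasShortExact A B D) (hA : ExtAcyclic.{w} A Y)
    (hD : ExtAcyclic.{w} D Y) : ExtAcyclic.{w} B Y :=
  fun i hi => h.subsingleton_ext_middle (hA i hi) (hD i hi)

lemma ExtAcyclic.left {A B D Y : C} (h : HasShortExact A B D) (hB : ExtAcyclic.{w} B Y)
    (hD : ExtAcyclic.{w} D Y) : ExtAcyclic.{w} A Y :=
  fun i hi => h.subsingleton_ext_left (hB i hi) (hD (i + 1) (by lia))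

lemma ExtAcyclic.of_retract {M M' Y : C} (r : Retract M M') (h : ExtAcyclic.{w} M' Y) :
    ExtAcyclic.{w} M Y := fun i hi => by
  have := h i hi
  refine subsingleton_of_forall_eq 0 fun x => ?_
  have hx : (Abelian.Ext.mk₀ r.i).comp ((Abelian.Ext.mk₀ r.r).comp x (zero_add i))
      (zero_add i) = x := by simp
  rw [← hx, Subsingleton.elim ((Abelian.Ext.mk₀ r.r).comp x (zero_add i)) 0,
    Abelian.Ext.comp_zero]

/-- Morphisms extend along a monomorphism if `Ext¹` of the cokernel vanishes. -/
lemma ShortExact.exists_extension {A B D Y : C} {f : A ⟶ B} {g : B ⟶ D} {h : f ≫ g = 0}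
    (hS : (ShortComplex.mk f g h).ShortExact) (hY : Subsingleton (Abelian.Ext.{w} D Y 1))
    (k : A ⟶ Y) : ∃ l : B ⟶ Y, f ≫ l = k := by
  obtain ⟨φ, hφ⟩ := Abelian.Ext.contravariant_sequence_exact₁ hS Y (Abelian.Ext.mk₀ k)
    (add_zero 1) (Subsingleton.elim _ _)
  obtain ⟨φ, rfl⟩ := Abelian.Ext.homEquiv₀.symm.surjective φ
  exact ⟨φ, Abelian.Ext.homEquiv₀.symm.injective (by simpa using hφ)⟩

lemma HasShortExact.nonempty_iso_biprod {A B D : C} (h : HasShortExact A B D)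
    (hY : Subsingleton (Abelian.Ext.{w} D A 1)) : Nonempty (B ≅ A ⊞ D) := by
  obtain ⟨f, g, w, hS⟩ := h
  have := hS.epi_g
  obtain ⟨l, hl⟩ := ShortExact.exists_extension hS hY (𝟙 A)
  exact ⟨(ShortComplex.Splitting.ofExactOfRetraction _ hS.exact l hl this).isoBinaryBiproduct⟩

/-- If all morphisms to `Y` extend along a monomorphism into an object `B` with `Ext¹(B, Y) = 0`,
then `Ext¹` from the cokernel to `Y` vanishes. -/
lemma ShortExact.subsingleton_ext_one {A B D Y : C} {f : A ⟶ B} {g : B ⟶ D} {h : f ≫ g = 0}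
    (hS : (ShortComplex.mk f g h).ShortExact) (hB : Subsingleton (Abelian.Ext.{w} B Y 1))
    (hY : ∀ k : A ⟶ Y, ∃ l : B ⟶ Y, f ≫ l = k) : Subsingleton (Abelian.Ext.{w} D Y 1) := by
  refine subsingleton_of_forall_eq 0 fun x => ?_
  obtain ⟨y, rfl⟩ := Abelian.Ext.contravariant_sequence_exact₃ hS Y x (Subsingleton.elim _ _)
    (add_zero 1)
  obtain ⟨k, rfl⟩ := Abelian.Ext.homEquiv₀.symm.surjective y
  obtain ⟨l, rfl⟩ := hY k
  have := hS.extClass_comp_assoc (Abelian.Ext.mk₀ l) (h := add_zero 1)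
  simpa [Abelian.Ext.mk₀_comp_mk₀] using this

end ExtVanishing

/-! ### Coresolving classes and complete resolutions -/

section Coresolving

lemma exists_int_sequence {T : Type*} (R : T → T → Prop) (hr : ∀ a, ∃ b, R a b)
    (hl : ∀ b, ∃ a, R a b) (a : T) : ∃ z : ℤ → T, z 0 = a ∧ ∀ m, R (z m) (z (m + 1)) := by
  choose f hf using hr
  choose g hg using hl
  -- `negSucc k` is `-(k + 1)`, hence `k + 1` backward steps.
  refine ⟨fun m => match m with
    | .ofNat k => f^[k] a
    | .negSucc k => g^[k + 1] a, rfl, fun m => ?_⟩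
  match m with
  | .ofNat k =>
    change R (f^[k] a) (f^[k + 1] a)
    rw [Function.iterate_succ_apply']
    exact hf _
  | .negSucc 0 => exact hg a
  | .negSucc (k + 1) =>
    change R (g^[k + 1 + 1] a) (g^[k + 1] a)
    rw [Function.iterate_succ_apply' g (k + 1)]
    exact hg _

section Splice

variable {K : CochainComplex C ℤ} {Z : ℤ → C} {i : ∀ m, Z m ⟶ K.X m} {p : ∀ m, K.X m ⟶ Z (m + 1)}
  {w : ∀ m, i m ≫ p m = 0}

/-- A complex spliced from short exact sequences `0 → Z m → X m → Z (m + 1) → 0` is exact. -/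
lemma acyclic_of_splice (hS : ∀ m, (ShortComplex.mk (i m) (p m) (w m)).ShortExact)
    (hd : ∀ m, K.d m (m + 1) = p m ≫ i (m + 1)) : K.Acyclic := by
  intro m
  obtain ⟨m, rfl⟩ : ∃ k, m = k + 1 := ⟨m - 1, by lia⟩
  rw [K.exactAt_iff_exact_up_to_refinements m (m + 1) (m + 1 + 1) (by simp) (by simp)]
  intro A x hx
  have := (hS (m + 1 + 1)).mono_f
  have : Epi (p m) := (hS m).epi_g
  rw [hd, ← Category.assoc] at hx
  obtain ⟨l, hl⟩ := ShortExact.exists_lift (hS (m + 1)) x (zero_of_comp_mono _ hx)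
  obtain ⟨A', π, hπ, y, hy⟩ := surjective_up_to_refinements_of_epi (p m) l
  exact ⟨A', π, hπ, y, by rw [hd, ← hl, reassoc_of% hy]⟩

/-- The cycles of a complex spliced from short exact sequences `0 → Z m → X m → Z (m + 1) → 0`. -/
lemma nonempty_cycles_iso_of_splice (hS : ∀ m, (ShortComplex.mk (i m) (p m) (w m)).ShortExact)
    (hd : ∀ m, K.d m (m + 1) = p m ≫ i (m + 1)) (m : ℤ) : Nonempty (K.cycles m ≅ Z m) := by
  have := (hS m).mono_f
  dsimp at this
  have := (hS (m + 1)).mono_f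
  have h0 : i m ≫ K.d m (m + 1) = 0 := by rw [hd, reassoc_of% (w m), zero_comp]
  obtain ⟨l, hl⟩ := ShortExact.exists_lift (hS m) (K.iCycles m)
    (zero_of_comp_mono (i (m + 1)) (by rw [Category.assoc, ← hd, K.iCycles_d]))
  exact ⟨⟨l, K.liftCycles (i m) (m + 1) (by simp) h0,
    by rw [← cancel_mono (K.iCycles m)]; simp [hl],
    by rw [← cancel_mono (i m)]; simp [hl]⟩⟩

/-- A cocycle on `X (m + 1)` kills `Z (m + 1)`, so it factors through `Z (m + 2)`; it then extends
to `X (m + 2)` because `Ext¹(Z (m + 3), Y) = 0`. -/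
lemma homExact_of_splice [HasExt.{w} C] {𝒴 : ObjectProperty C}
    (hS : ∀ m, (ShortComplex.mk (i m) (p m) (w m)).ShortExact)
    (hd : ∀ m, K.d m (m + 1) = p m ≫ i (m + 1))
    (hZ : ∀ m ⦃Y : C⦄, 𝒴 Y → Subsingleton (Abelian.Ext.{w} (Z m) Y 1)) : HomExact 𝒴 K := by
  refine fun Y hY m f => ⟨fun hf => ?_, ?_⟩
  · have : Epi (p m) := (hS _).epi_g
    have h1 : i (m + 1) ≫ f = 0 := by
      rw [← cancel_epi (p m)]
      simpa [hd] using hf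
    obtain ⟨g, hg⟩ := ShortExact.exists_desc (hS (m + 1)) _ h1
    obtain ⟨l, hl⟩ := ShortExact.exists_extension (hS (m + 1 + 1)) (hZ (m + 1 + 1 + 1) hY) g
    exact ⟨l, by simp [hd, hl, hg]⟩
  · rintro ⟨g, rfl⟩
    simp

end Splice

variable [HasExt.{w} C]

/-- A class of objects of `^⊥𝒴`, each of which embeds in an object of `𝒳` with cokernel again in
the class. -/
def IsCoresolving (𝒳 𝒴 𝒢 : ObjectProperty C) : Prop :=
  ∀ ⦃M : C⦄, 𝒢 M → (∀ ⦃Y⦄, 𝒴 Y → ExtAcyclic.{w} M Y) ∧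
    ∃ X M', 𝒳 X ∧ 𝒢 M' ∧ HasShortExact M X M'

/-- The union of all coresolving classes. -/
def maxCoresolving (𝒳 𝒴 : ObjectProperty C) : ObjectProperty C :=
  fun M => ∃ 𝒢 : ObjectProperty C, IsCoresolving.{w} 𝒳 𝒴 𝒢 ∧ 𝒢 M

lemma isCoresolving_max (𝒳 𝒴 : ObjectProperty C) :
    IsCoresolving.{w} 𝒳 𝒴 (maxCoresolving.{w} 𝒳 𝒴) := by
  rintro M ⟨𝒢, h𝒢, hM⟩
  obtain ⟨h, X, M', hX, hM', hS⟩ := h𝒢 hM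
  exact ⟨h, X, M', hX, ⟨𝒢, h𝒢, hM'⟩, hS⟩

lemma maxCoresolving_of_shortExact {𝒳 𝒴 : ObjectProperty C} {M X M' : C}
    (hM : ∀ ⦃Y⦄, 𝒴 Y → ExtAcyclic.{w} M Y) (hX : 𝒳 X) (hM' : maxCoresolving.{w} 𝒳 𝒴 M')
    (hS : HasShortExact M X M') : maxCoresolving.{w} 𝒳 𝒴 M := by
  -- Adjoining `M` to the maximal class leaves it coresolving.
  refine ⟨fun N => N = M ∨ maxCoresolving.{w} 𝒳 𝒴 N, ?_, Or.inl rfl⟩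
  rintro N (rfl | hN)
  · exact ⟨hM, X, M', hX, Or.inr hM', hS⟩
  · obtain ⟨h, X, M', hX, hM', hS⟩ := isCoresolving_max 𝒳 𝒴 hN
    exact ⟨h, X, M', hX, Or.inr hM', hS⟩

lemma IsGPAdmissible.gp_of_maxCoresolving {𝒳 𝒴 : ObjectProperty C}
    (hadm : IsGPAdmissible.{w} 𝒳 𝒴) {M : C} (hM : maxCoresolving.{w} 𝒳 𝒴 M) : GP 𝒳 𝒴 M := by
  obtain ⟨z, hz0, hz⟩ := exists_int_sequence
    (fun a b : { N // maxCoresolving.{w} 𝒳 𝒴 N } => ∃ X, 𝒳 X ∧ HasShortExact a.1 X b.1)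
    (fun a => by
      obtain ⟨-, X, M', hX, hM', hS⟩ := isCoresolving_max 𝒳 𝒴 a.2
      exact ⟨⟨M', hM'⟩, X, hX, hS⟩)
    (fun b => by
      obtain ⟨X, f, hX, hf⟩ := hadm.exists_epi b.1
      have hS : HasShortExact (kernel f) X b.1 := ⟨_, _, _, shortExact_kernel f⟩
      exact ⟨⟨kernel f, maxCoresolving_of_shortExact (fun Y hY => ExtAcyclic.left hS
        (fun i hi => hadm.orthogonal hX hY i hi) ((isCoresolving_max 𝒳 𝒴 b.2).1 hY)) hX b.2 hS⟩,
        X, hX, hS⟩)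
    ⟨M, hM⟩
  choose X hX i p w hS using hz
  let K := CochainComplex.of X (fun m => p m ≫ i (m + 1))
    (fun m => by simp [reassoc_of% (w (m + 1))])
  have hd : ∀ m, K.d m (m + 1) = p m ≫ i (m + 1) :=
    CochainComplex.of_d X (fun m => p m ≫ i (m + 1))
  refine ⟨K, acyclic_of_splice (K := K) hS hd, hX, homExact_of_splice (K := K) hS hd
    fun m Y hY => (isCoresolving_max 𝒳 𝒴 (z m).2).1 hY 1 one_pos, 0, ?_⟩
  simpa only [hz0] using nonempty_cycles_iso_of_splice (K := K) hS hd 0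

end Coresolving

/-! ### Closure properties of Gorenstein projective objects -/

section GorensteinProjective

lemma shortExact_cycles (K : CochainComplex C ℤ) (hK : K.Acyclic) (m : ℤ) :
    ∃ h, (ShortComplex.mk (K.iCycles m) (K.toCycles m (m + 1)) h).ShortExact := by
  have hw : K.iCycles m ≫ K.toCycles m (m + 1) = 0 := by
    rw [← cancel_mono (K.iCycles (m + 1))]; simp
  have : Epi (K.toCycles m (m + 1)) := by
    rw [epi_iff_surjective_up_to_refinements]
    intro A x
    obtain ⟨A', π, hπ, y, hy⟩ := (K.exactAt_iff_exact_up_to_refinements m (m + 1) (m + 1 + 1)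
      (by simp) (by simp)).1 (hK (m + 1)) (x ≫ K.iCycles (m + 1)) (by simp)
    exact ⟨A', π, hπ, y, by rw [← cancel_mono (K.iCycles (m + 1))]; simpa using hy⟩
  have hex : (ShortComplex.mk _ _ hw).Exact := ShortComplex.exact_of_f_is_kernel _
    (KernelFork.IsLimit.ofι' _ hw fun k hk => ⟨K.liftCycles k (m + 1) (by simp)
      (by simpa using hk =≫ K.iCycles (m + 1)), by simp⟩)
  exact ⟨hw, { exact := hex }⟩

variable [HasExt.{w} C] {𝒳 𝒴 : ObjectProperty C}

lemma extAcyclic_cycles (h𝒳 : ExtOrthogonal.{w} 𝒳 𝒴) (K : CochainComplex C ℤ) (hK : K.Acyclic)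
    (hX : ∀ m, 𝒳 (K.X m)) (hY : HomExact 𝒴 K) {Y : C} (h : 𝒴 Y) (m : ℤ) :
    ExtAcyclic.{w} (K.cycles m) Y := by
  suffices ∀ (i : ℕ) (m : ℤ), Subsingleton (Abelian.Ext.{w} (K.cycles m) Y (i + 1)) by
    intro i hi
    obtain ⟨i, rfl⟩ := Nat.exists_eq_add_of_lt hi
    simpa [add_comm] using this i m
  intro i
  induction i with
  | zero =>
    intro m
    -- A map `Z (m + 2) → Y` pulls back to a cocycle on `X (m + 1)`, which exactness of `Hom(K, Y)`
    -- there extends to `X (m + 2)`.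
    obtain ⟨m, rfl⟩ : ∃ k, m = k + 1 + 1 + 1 := ⟨m - 3, by lia⟩
    obtain ⟨w, hS⟩ := shortExact_cycles K hK (m + 1 + 1)
    refine ShortExact.subsingleton_ext_one hS (h𝒳 (hX _) h 1 one_pos) fun k => ?_
    obtain ⟨l, hl⟩ := ((hY h m) (K.toCycles (m + 1) (m + 1 + 1) ≫ k)).1 (by simp)
    refine ⟨l, ?_⟩
    have := (shortExact_cycles K hK (m + 1)).choose_spec.epi_g
    dsimp at this
    rw [← cancel_epi (K.toCycles (m + 1) (m + 1 + 1))]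
    simpa using hl
  | succ i ih =>
    intro m
    obtain ⟨m, rfl⟩ : ∃ k, m = k + 1 := ⟨m - 1, by lia⟩
    obtain ⟨w, hS⟩ := shortExact_cycles K hK m
    exact HasShortExact.subsingleton_ext_right ⟨_, _, w, hS⟩ (ih m)
      (h𝒳 (hX _) h _ (by lia))

lemma isCoresolving_gp (h𝒳 : ExtOrthogonal.{w} 𝒳 𝒴) : IsCoresolving.{w} 𝒳 𝒴 (GP 𝒳 𝒴) := by
  rintro M ⟨K, hK, hX, hY, m, ⟨e⟩⟩
  refine ⟨fun Y h => ExtAcyclic.of_retract e.symm.retract (extAcyclic_cycles h𝒳 K hK hX hY h m),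
    K.X m, K.cycles (m + 1), hX m, ⟨K, hK, hX, hY, m + 1, ⟨Iso.refl _⟩⟩, ?_⟩
  obtain ⟨w, hS⟩ := shortExact_cycles K hK m
  exact HasShortExact.of_iso ⟨_, _, w, hS⟩ e (Iso.refl _) (Iso.refl _)

omit [HasExt.{w} C] in
lemma GP.of_iso {M N : C} (h : GP 𝒳 𝒴 M) (e : M ≅ N) : GP 𝒳 𝒴 N := by
  obtain ⟨K, hK, hX, hY, m, ⟨e'⟩⟩ := h
  exact ⟨K, hK, hX, hY, m, ⟨e' ≪≫ e⟩⟩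

namespace IsGPAdmissible

variable (hadm : IsGPAdmissible.{w} 𝒳 𝒴)
include hadm

/-- A class of objects of `^⊥𝒴` embedding in objects of `𝒳` with cokernel in the class or in `GP`
consists of Gorenstein projective objects. -/
lemma gp_of_isCoresolving {𝒢 : ObjectProperty C}
    (h : ∀ ⦃M : C⦄, 𝒢 M → (∀ ⦃Y⦄, 𝒴 Y → ExtAcyclic.{w} M Y) ∧
      ∃ X M', 𝒳 X ∧ (𝒢 M' ∨ GP 𝒳 𝒴 M') ∧ HasShortExact M X M') {M : C} (hM : 𝒢 M) :
    GP 𝒳 𝒴 M := by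
  refine hadm.gp_of_maxCoresolving ⟨fun N => 𝒢 N ∨ GP 𝒳 𝒴 N, ?_, Or.inl hM⟩
  rintro N (hN | hN)
  · exact h hN
  · obtain ⟨h, X, M', hX, hM', hS⟩ := isCoresolving_gp hadm.orthogonal hN
    exact ⟨h, X, M', hX, Or.inr hM', hS⟩

lemma extAcyclic_gp {M Y : C} (hM : GP 𝒳 𝒴 M) (hY : 𝒴 Y) : ExtAcyclic.{w} M Y :=
  (isCoresolving_gp hadm.orthogonal hM).1 hY

/-- With `Z` embedded in `X' ∈ 𝒳`, the pushout is an extension of `X` by `X'`, hence in `𝒳`. This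
special case yields the cogenerator needed for general extensions. -/
lemma extension_of_left {Z B X : C} (hS : HasShortExact Z B X) (hZ : GP 𝒳 𝒴 Z) (hX : 𝒳 X) :
    GP 𝒳 𝒴 B := by
  refine hadm.gp_of_isCoresolving
    (𝒢 := fun B => ∃ Z X, HasShortExact Z B X ∧ GP 𝒳 𝒴 Z ∧ 𝒳 X) ?_ ⟨Z, X, hS, hZ, hX⟩
  rintro B ⟨Z, X, hS, hZ, hX⟩
  obtain ⟨hZ', X', Z', hX', hZ'', hS'⟩ := isCoresolving_gp hadm.orthogonal hZ
  obtain ⟨Q, hQ, hQ'⟩ := hS.exists_pushout hS'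
  refine ⟨fun Y hY => ExtAcyclic.middle hS (hZ' hY) (hadm.orthogonal hX hY),
    Q, Z', ?_, Or.inr hZ'', hQ'⟩
  obtain ⟨f, g, w, h⟩ := hQ
  exact hadm.left_extensions.prop_X₂_of_shortExact h hX' hX

/-- `𝒳 ∩ 𝒴` is a relative cogenerator in `GP`. -/
lemma exists_gp_cogenerator {M : C} (hM : GP 𝒳 𝒴 M) :
    ∃ W M', (𝒳 W ∧ 𝒴 W) ∧ GP 𝒳 𝒴 M' ∧ HasShortExact M W M' := by
  obtain ⟨-, X, Z, hX, hZ, hS⟩ := isCoresolving_gp hadm.orthogonal hM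
  obtain ⟨W, X', f, g, w, hS', hW, hX'⟩ := hadm.exists_cogenerator X hX
  -- `Q = W / M` is an extension of `X'` by `Z`.
  obtain ⟨Q, hQ, hQ'⟩ := hS.exists_cokernel_comp ⟨f, g, w, hS'⟩
  exact ⟨W, Q, hW, hadm.extension_of_left hQ' hZ hX', hQ⟩

/-- A horseshoe argument: pushing out along `A → W` gives an extension of `D` by `W`, split since `W
∈ 𝒴`. Then `B` embeds in `W ⊞ D`, hence in `W ⊞ V`, with cokernel an extension of `D'` by `A'`. -/
lemma gp_extension {A B D : C} (hS : HasShortExact A B D) (hA : GP 𝒳 𝒴 A) (hD : GP 𝒳 𝒴 D) :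
    GP 𝒳 𝒴 B := by
  refine hadm.gp_of_isCoresolving
    (𝒢 := fun B => ∃ A D, HasShortExact A B D ∧ GP 𝒳 𝒴 A ∧ GP 𝒳 𝒴 D) ?_ ⟨A, D, hS, hA, hD⟩
  rintro B ⟨A, D, hS, hA, hD⟩
  refine ⟨fun Y hY => ExtAcyclic.middle hS (hadm.extAcyclic_gp hA hY)
    (hadm.extAcyclic_gp hD hY), ?_⟩
  obtain ⟨W, A', hW, hA', hSA⟩ := hadm.exists_gp_cogenerator hA
  obtain ⟨V, D', hV, hD', hSD⟩ := hadm.exists_gp_cogenerator hD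
  obtain ⟨Q, hQ, hQ'⟩ := hS.exists_pushout hSA
  obtain ⟨e⟩ := hQ.nonempty_iso_biprod (hadm.extAcyclic_gp hD hW.2 1 one_pos)
  obtain ⟨R, hR, hR'⟩ := (hQ'.of_iso (Iso.refl _) e (Iso.refl _)).exists_cokernel_comp
    (hSD.biprod_left W)
  have := hadm.left_extensions
  exact ⟨W ⊞ V, R, 𝒳.prop_biprod hW.1 hV.1, Or.inl ⟨A', D', hR', hA', hD'⟩, hR⟩

/-- If `M ⊞ N` embeds in `W` with cokernel `G`, then `Q = W / M` is an extension of `G` by `N`. So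
`M ⊞ Q` is an extension of `G` by `M ⊞ N`, and `Q` is again a summand of a Gorenstein projective. -/
lemma gp_of_biprod {M N : C} (h : GP 𝒳 𝒴 (M ⊞ N)) : GP 𝒳 𝒴 M := by
  refine hadm.gp_of_isCoresolving (𝒢 := fun M => ∃ N, GP 𝒳 𝒴 (M ⊞ N)) ?_ ⟨N, h⟩
  rintro M ⟨N, h⟩
  refine ⟨fun Y hY => ExtAcyclic.of_retract ⟨biprod.inl, biprod.fst, by simp⟩
    (hadm.extAcyclic_gp h hY), ?_⟩
  obtain ⟨W, G, hW, hG, hS⟩ := hadm.exists_gp_cogenerator h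
  obtain ⟨Q, hQ, hQ'⟩ := (hasShortExact_biprod M N).exists_cokernel_comp hS
  exact ⟨W, Q, hW.1, Or.inl ⟨M, (hadm.gp_extension (hQ'.biprod_left M) h hG).of_iso
    (biprod.braiding _ _)⟩, hQ⟩

end IsGPAdmissible

end GorensteinProjective

/-! ### Finite resolutions, one term at a time -/

section Resolution

lemma acyclic_nat_iff (K : ChainComplex C ℕ) :
    K.Acyclic ↔ Epi (K.d 1 0) ∧ ∀ i, (ShortComplex.mk (K.d (i + 2) (i + 1)) (K.d (i + 1) i)
      (K.d_comp_d _ _ _)).Exact := by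
  have h0 : K.ExactAt 0 ↔ Epi (K.d 1 0) := by
    rw [K.exactAt_iff' 1 0 0 (by simp) (by simp)]
    exact ShortComplex.exact_iff_epi _ (K.shape _ _ (by simp))
  have hs : ∀ i, K.ExactAt (i + 1) ↔ (ShortComplex.mk (K.d (i + 2) (i + 1)) (K.d (i + 1) i)
      (K.d_comp_d _ _ _)).Exact := fun i =>
    K.exactAt_iff' (i + 2) (i + 1) i (by simp) (by simp)
  refine ⟨fun h => ⟨h0.1 (h 0), fun i => (hs i).1 (h _)⟩, fun h i => ?_⟩
  cases i with
  | zero => exact h0.2 h.1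
  | succ i => exact (hs i).2 (h.2 i)

lemma acyclic_augment (T : ChainComplex C ℕ) {X : C} (f : T.X 0 ⟶ X) (h : T.d 1 0 ≫ f = 0)
    (hf : Epi f) (h₁ : (ShortComplex.mk _ _ h).Exact)
    (h₂ : ∀ i, (ShortComplex.mk (T.d (i + 2) (i + 1)) (T.d (i + 1) i)
      (T.d_comp_d _ _ _)).Exact) : (T.augment f h).Acyclic := by
  rw [acyclic_nat_iff]
  refine ⟨hf, fun i => ?_⟩
  cases i with
  | zero => exact h₁
  | succ i => exact h₂ i

lemma exact_of_comp_mono {A B D E : C} {a : A ⟶ B} {b : B ⟶ D} (m : D ⟶ E) [Mono m]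
    {w : a ≫ b = 0} {b' : B ⟶ E} (hb : b ≫ m = b') (w' : a ≫ b' = 0) :
    (ShortComplex.mk a b w).Exact ↔ (ShortComplex.mk a b' w').Exact := by
  let φ : ShortComplex.mk a b w ⟶ ShortComplex.mk a b' w' :=
    { τ₁ := 𝟙 _, τ₂ := 𝟙 _, τ₃ := m, comm₂₃ := by simp [hb] }
  have : Epi φ.τ₁ := inferInstanceAs (Epi (𝟙 A))
  have : IsIso φ.τ₂ := inferInstanceAs (IsIso (𝟙 B))
  have : Mono φ.τ₃ := ‹Mono m›
  exact ShortComplex.exact_iff_of_epi_of_isIso_of_mono φ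

lemma exact_of_epi_comp {A A' B D : C} {a : A ⟶ B} {b : B ⟶ D} (q : A' ⟶ A) [Epi q]
    {w : a ≫ b = 0} {a' : A' ⟶ B} (ha : q ≫ a = a') (w' : a' ≫ b = 0) :
    (ShortComplex.mk a' b w').Exact ↔ (ShortComplex.mk a b w).Exact := by
  let φ : ShortComplex.mk a' b w' ⟶ ShortComplex.mk a b w :=
    { τ₁ := q, τ₂ := 𝟙 _, τ₃ := 𝟙 _, comm₁₂ := by simp [ha] }
  have : Epi φ.τ₁ := ‹Epi q›
  have : IsIso φ.τ₂ := inferInstanceAs (IsIso (𝟙 B))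
  have : Mono φ.τ₃ := inferInstanceAs (Mono (𝟙 D))
  exact ShortComplex.exact_iff_of_epi_of_isIso_of_mono φ

/-- Splicing a short exact sequence `0 → L → G → M → 0` to an exact complex ending in `L`. -/
lemma exists_acyclic_splice {K : ChainComplex C ℕ} (hK : K.Acyclic) {L G M : C} (e : K.X 0 ≅ L)
    (h : HasShortExact L G M) :
    ∃ K' : ChainComplex C ℕ, K'.Acyclic ∧ K'.X 0 = M ∧ K'.X 1 = G ∧
      ∀ i, K'.X (i + 2) = K.X (i + 1) := by
  obtain ⟨i, p, w, hS⟩ := h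
  have : Mono i := hS.mono_f
  rw [acyclic_nat_iff] at hK
  have := hK.1
  have hj : ∀ j, (ShortComplex.mk (K.d (j + 2) (j + 1)) (K.d (j + 1) j)
    (K.d_comp_d _ _ _)).Exact := hK.2
  let f : K.X 1 ⟶ G := K.d 1 0 ≫ e.hom ≫ i
  have hw : K.d 2 1 ≫ f = 0 := by simp [f]
  have hw' : f ≫ p = 0 := by simp [f, w]
  let T : ChainComplex C ℕ := (ChainComplex.truncate.obj K).augment f hw
  refine ⟨T.augment p hw', acyclic_augment T p hw' hS.epi_g ?_ fun j => ?_, rfl, rfl, fun _ => rfl⟩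
  · exact (exact_of_epi_comp (K.d 1 0 ≫ e.hom) (by simp [f]) hw').2 hS.exact
  · cases j with
    | zero => exact (exact_of_comp_mono (e.hom ≫ i) rfl hw).1 (hj 0)
    | succ j => exact hj (j + 1)

/-- Removing the term of degree `0` from an exact complex. -/
lemma exists_acyclic_kernel {K : ChainComplex C ℕ} (hK : K.Acyclic) :
    ∃ K' : ChainComplex C ℕ, K'.Acyclic ∧ HasShortExact (K'.X 0) (K.X 1) (K.X 0) ∧
      ∀ i, K'.X (i + 1) = K.X (i + 2) := by
  rw [acyclic_nat_iff] at hK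
  have := hK.1
  have hj : ∀ j, (ShortComplex.mk (K.d (j + 2) (j + 1)) (K.d (j + 1) j)
    (K.d_comp_d _ _ _)).Exact := hK.2
  let T := ChainComplex.truncate.obj (ChainComplex.truncate.obj K)
  let f : K.X 2 ⟶ kernel (K.d 1 0) := kernel.lift _ (K.d 2 1) (K.d_comp_d _ _ _)
  have hf : f ≫ kernel.ι _ = K.d 2 1 := kernel.lift_ι _ _ _
  have hw : K.d 3 2 ≫ f = 0 := by
    rw [← cancel_mono (kernel.ι _), Category.assoc, hf, zero_comp, K.d_comp_d]
  exact ⟨T.augment f hw, acyclic_augment T f hw (hj 0).epi_kernelLift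
    ((exact_of_comp_mono (kernel.ι _) hf (K.d_comp_d _ _ _)).2 (hj 1)) (fun i => hj (i + 2)),
    ⟨_, _, _, shortExact_kernel (K.d 1 0)⟩, fun _ => rfl⟩

lemma acyclic_of_isZero {ι : Type*} {c : ComplexShape ι} {K : HomologicalComplex C c}
    (h : ∀ i, IsZero (K.X i)) : K.Acyclic := fun i =>
  ShortComplex.exact_of_isZero_X₂ _ (h i)

variable {P : ObjectProperty C}

lemma hasFiniteResolution_zero_iff {M : C} :
    HasFiniteResolution P M 0 ↔ ∃ G, P G ∧ Nonempty (G ≅ M) := by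
  constructor
  · rintro ⟨K, hK, ⟨e⟩, hP, hz⟩
    rw [acyclic_nat_iff] at hK
    have := hK.1
    have hm : Mono (K.d 1 0) := (hK.2 0).mono_g ((hz 2 (by simp)).eq_of_src _ _)
    have := isIso_of_mono_of_epi (K.d 1 0)
    exact ⟨K.X 1, hP 0 le_rfl, ⟨asIso (K.d 1 0) ≪≫ e⟩⟩
  · rintro ⟨G, hG, ⟨e⟩⟩
    obtain ⟨Z, hZ⟩ := HasZeroObject.zero (C := C)
    let K : ChainComplex C ℕ := ChainComplex.of (fun _ => Z) (fun _ => 0) (by simp)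
    have hK : ∀ i, IsZero (K.X i) := fun _ => hZ
    obtain ⟨K', hK', h0, h1, h2⟩ := exists_acyclic_splice (acyclic_of_isZero hK) (Iso.refl _)
      ((hasShortExact_zero G _ (hK 0)).of_iso (Iso.refl _) (Iso.refl _) e)
    refine ⟨K', hK', ⟨eqToIso h0⟩, fun i hi => ?_, fun i hi => ?_⟩
    · obtain rfl : i = 0 := by lia
      rwa [h1]
    · obtain ⟨i, rfl⟩ : ∃ k, i = k + 2 := ⟨i - 2, by lia⟩
      rw [h2]
      exact hK _

lemma hasFiniteResolution_succ_iff {M : C} {n : ℕ} :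
    HasFiniteResolution P M (n + 1) ↔
      ∃ L G, HasFiniteResolution P L n ∧ P G ∧ HasShortExact L G M := by
  constructor
  · rintro ⟨K, hK, ⟨e⟩, hP, hz⟩
    obtain ⟨K', hK', hS, h⟩ := exists_acyclic_kernel hK
    refine ⟨K'.X 0, K.X 1, ⟨K', hK', ⟨Iso.refl _⟩, fun i hi => ?_, fun i hi => ?_⟩, hP 0 (by lia),
      hS.of_iso (Iso.refl _) (Iso.refl _) e⟩
    · rw [h]
      exact hP (i + 1) (by lia)
    · obtain ⟨i, rfl⟩ : ∃ k, i = k + 1 := ⟨i - 1, by lia⟩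
      rw [h]
      exact hz _ (by lia)
  · rintro ⟨L, G, ⟨K, hK, ⟨e⟩, hP, hz⟩, hG, hS⟩
    obtain ⟨K', hK', h0, h1, h2⟩ := exists_acyclic_splice hK e hS
    refine ⟨K', hK', ⟨eqToIso h0⟩, fun j hj => ?_, fun j hj => ?_⟩
    · cases j with
      | zero => rwa [h1]
      | succ j =>
        rw [h2]
        exact hP j (by lia)
    · obtain ⟨j, rfl⟩ : ∃ k, j = k + 2 := ⟨j - 2, by lia⟩
      rw [h2]
      exact hz (j + 1) (by lia)

lemma exists_hasFiniteResolution_of_resdim_le {M : C} {n : ℕ} (h : resdim P M ≤ n) :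
    ∃ m ≤ n, HasFiniteResolution P M m := by
  by_contra! H
  have : ((n + 1 : ℕ) : ℕ∞) ≤ resdim P M := le_iInf₂ fun m hm => by
    by_contra! hlt
    exact H m (Nat.lt_succ_iff.1 (by exact_mod_cast hlt)) hm
  exact absurd (Nat.cast_le.1 (this.trans h)) (by simp)

/-- The length counts every term up to degree `n`, so padding by zero requires a zero object in `P`.
-/
lemma HasFiniteResolution.succ (h0 : ∃ Z, IsZero Z ∧ P Z) {M : C} {n : ℕ}
    (h : HasFiniteResolution P M n) : HasFiniteResolution P M (n + 1) := by
  obtain ⟨Z, hZ, hPZ⟩ := h0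
  induction n generalizing M with
  | zero =>
    obtain ⟨G, hG, ⟨e⟩⟩ := hasFiniteResolution_zero_iff.1 h
    exact hasFiniteResolution_succ_iff.2 ⟨Z, G,
      hasFiniteResolution_zero_iff.2 ⟨Z, hPZ, ⟨Iso.refl _⟩⟩, hG,
      (hasShortExact_zero G Z hZ).of_iso (Iso.refl _) (Iso.refl _) e⟩
  | succ n ih =>
    obtain ⟨L, G, hL, hG, hS⟩ := hasFiniteResolution_succ_iff.1 h
    exact hasFiniteResolution_succ_iff.2 ⟨L, G, ih hL, hG, hS⟩

lemma HasFiniteResolution.mono (h0 : ∃ Z, IsZero Z ∧ P Z) {M : C} {m n : ℕ}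
    (h : HasFiniteResolution P M m) (hmn : m ≤ n) : HasFiniteResolution P M n := by
  induction n, hmn using Nat.le_induction with
  | base => exact h
  | succ n _ ih => exact ih.succ h0

lemma resdim_le_iff (h0 : ∃ Z, IsZero Z ∧ P Z) {M : C} {n : ℕ} :
    resdim P M ≤ n ↔ HasFiniteResolution P M n := by
  refine ⟨fun h => ?_, fun h => iInf₂_le n h⟩
  obtain ⟨m, hm, h⟩ := exists_hasFiniteResolution_of_resdim_le h
  exact h.mono h0 hm

end Resolution

/-! ### Retracts and finite projective resolutions -/

section Projective

lemma exists_isZero_isProjective : ∃ Z : C, IsZero Z ∧ isProjective C Z :=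
  have ⟨Z, hZ⟩ := HasZeroObject.zero (C := C)
  ⟨Z, hZ, ⟨fun _ _ _ => ⟨0, hZ.eq_of_src _ _⟩⟩⟩

/-- A kernel of an epimorphism from a projective object to a retract of `N` is a retract of a
biproduct of the projective with the corresponding kernel for `N`. -/
lemma HasShortExact.exists_kernel_retract {L G N M : C} (hG : Projective G)
    (h : HasShortExact L G N) (r : Retract M N) :
    ∃ L', HasShortExact L' G M ∧ Nonempty (Retract L' (L ⊞ G)) := by
  obtain ⟨i, p, w, hS⟩ := h
  have : Epi p := hS.epi_g
  have : Mono i := hS.mono_f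
  have : Epi r.r := inferInstance
  have : Epi (p ≫ r.r) := epi_comp _ _
  refine ⟨kernel (p ≫ r.r), ⟨_, _, _, shortExact_kernel (p ≫ r.r)⟩, ?_⟩
  -- `a` lifts the idempotent of `N` defining `M`. On the new kernel, `a` lands in `L`, while `𝟙 G -
  -- a` maps `G` into that kernel; the two parts sum to the identity.
  let a : G ⟶ G := Projective.factorThru (p ≫ r.r ≫ r.i) p
  have ha : a ≫ p = p ≫ r.r ≫ r.i := Projective.factorThru_comp _ _
  obtain ⟨s, hs⟩ := ShortExact.exists_lift hS (kernel.ι (p ≫ r.r) ≫ a)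
    (by rw [Category.assoc, ha, ← Category.assoc p, kernel.condition_assoc, zero_comp])
  have h1 : i ≫ p ≫ r.r = 0 := by rw [reassoc_of% w, zero_comp]
  have h2 : (𝟙 G - a) ≫ p ≫ r.r = 0 := by
    simp [reassoc_of% ha]
  refine ⟨⟨biprod.lift s (kernel.ι (p ≫ r.r)),
    biprod.desc (kernel.lift _ i h1) (kernel.lift _ (𝟙 G - a) h2), ?_⟩⟩
  rw [← cancel_mono (kernel.ι (p ≫ r.r))]
  simp [hs]

lemma HasFiniteResolution.biprod_projective {L G : C} (hG : Projective G) {n : ℕ}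
    (h : HasFiniteResolution (isProjective C) L n) :
    HasFiniteResolution (isProjective C) (L ⊞ G) n := by
  cases n with
  | zero =>
    obtain ⟨Q, hQ, ⟨e⟩⟩ := hasFiniteResolution_zero_iff.1 h
    have : Projective Q := hQ
    exact hasFiniteResolution_zero_iff.2 ⟨Q ⊞ G, inferInstanceAs (Projective (Q ⊞ G)),
      ⟨biprod.mapIso e (Iso.refl G)⟩⟩
  | succ n =>
    obtain ⟨K, Q, hK, hQ, hS⟩ := hasFiniteResolution_succ_iff.1 h
    have : Projective Q := hQ
    refine hasFiniteResolution_succ_iff.2 ⟨K, Q ⊞ G, hK, inferInstanceAs (Projective (Q ⊞ G)), ?_⟩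
    obtain ⟨i, p, w, hS⟩ := hS
    have : Mono i := hS.mono_f
    have : Epi p := hS.epi_g
    have : Mono (biprod.lift i (0 : K ⟶ G)) := mono_of_mono_fac (biprod.lift_fst i 0)
    refine ⟨biprod.lift i 0, biprod.map p (𝟙 G), by ext <;> simp [w],
      ShortExact.mk_of_exists_desc _ _ _ fun k hk => ?_⟩
    have hk' : i ≫ biprod.inl ≫ k = 0 := by
      simpa [biprod.lift_eq] using hk
    obtain ⟨l, hl⟩ := ShortExact.exists_desc hS _ hk'
    exact ⟨biprod.desc l (biprod.inr ≫ k), by ext <;> simp [hl]⟩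

/-- The class of objects with a projective resolution of length `n` is closed under retracts. -/
lemma HasFiniteResolution.of_retract {M N : C} (r : Retract M N) {n : ℕ}
    (h : HasFiniteResolution (isProjective C) N n) :
    HasFiniteResolution (isProjective C) M n := by
  induction n generalizing M N with
  | zero =>
    obtain ⟨Q, hQ, ⟨e⟩⟩ := hasFiniteResolution_zero_iff.1 h
    have : Projective Q := hQ
    have : Projective N := Projective.of_iso e inferInstance
    exact hasFiniteResolution_zero_iff.2 ⟨M, r.projective, ⟨Iso.refl _⟩⟩
  | succ n ih =>
    obtain ⟨L, G, hL, hG, hS⟩ := hasFiniteResolution_succ_iff.1 h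
    obtain ⟨L', hS', ⟨r'⟩⟩ := hS.exists_kernel_retract hG r
    exact hasFiniteResolution_succ_iff.2 ⟨L', G, ih r' (hL.biprod_projective hG), hG, hS'⟩

end Projective

/-! ### Orthogonality and approximations -/

section Cotorsion

variable [HasExt.{w} C]

/-- `Ext` vanishing on a class passes to finite resolutions in the second variable. -/
lemma ExtOrthogonal.hasFiniteResolution {𝒢 P : ObjectProperty C} (h : ExtOrthogonal.{w} 𝒢 P)
    {G N : C} (hG : 𝒢 G) {n : ℕ} (hN : HasFiniteResolution P N n) :
    ExtAcyclic.{w} G N := by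
  induction n generalizing N with
  | zero =>
    obtain ⟨Q, hQ, ⟨e⟩⟩ := hasFiniteResolution_zero_iff.1 hN
    intro i hi
    have := h hG hQ i hi
    refine subsingleton_of_forall_eq 0 fun x => ?_
    rw [← x.comp_mk₀_id, ← e.inv_hom_id, ← Abelian.Ext.mk₀_comp_mk₀,
      ← Abelian.Ext.comp_assoc_of_second_deg_zero,
      Subsingleton.elim (x.comp (Abelian.Ext.mk₀ e.inv) (add_zero i)) 0, Abelian.Ext.zero_comp]
  | succ n ih =>
    obtain ⟨L, Q, hL, hQ, hS⟩ := hasFiniteResolution_succ_iff.1 hN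
    exact fun i hi => hS.subsingleton_ext_target (h hG hQ i hi) (ih hL _ (by lia))

variable {𝒳 𝒴 : ObjectProperty C}

namespace IsGPAdmissible

variable (hadm : IsGPAdmissible.{w} 𝒳 𝒴) (hproj : 𝒳 ⊓ 𝒴 = isProjective C)
include hadm hproj

lemma extOrthogonal_gp_isProjective : ExtOrthogonal.{w} (GP 𝒳 𝒴) (isProjective C) := by
  rw [← hproj]
  exact fun X Y hX hY => hadm.extAcyclic_gp hX hY.2

lemma exists_gp_embedding {M : C} (hM : GP 𝒳 𝒴 M) :
    ∃ W M', isProjective C W ∧ GP 𝒳 𝒴 M' ∧ HasShortExact M W M' := by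
  rw [← hproj]
  exact hadm.exists_gp_cogenerator hM

/-- Approximation of objects of finite Gorenstein projective dimension. -/
lemma exists_approximations {A : C} {n : ℕ} (hA : HasFiniteResolution (GP 𝒳 𝒴) A n) :
    (∃ Y X, HasShortExact Y X A ∧ HasFiniteResolution (isProjective C) Y n ∧ GP 𝒳 𝒴 X) ∧
      ∃ Y X, HasShortExact A Y X ∧ HasFiniteResolution (isProjective C) Y n ∧ GP 𝒳 𝒴 X := by
  induction n generalizing A with
  | zero =>
    obtain ⟨G, hG, ⟨e⟩⟩ := hasFiniteResolution_zero_iff.1 hA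
    have hA : GP 𝒳 𝒴 A := hG.of_iso e
    obtain ⟨Z, hZ, hPZ⟩ := exists_isZero_isProjective (C := C)
    obtain ⟨W, M, hW, hM, hS⟩ := hadm.exists_gp_embedding hproj hA
    exact ⟨⟨Z, A, hasShortExact_zero A Z hZ,
      hasFiniteResolution_zero_iff.2 ⟨Z, hPZ, ⟨Iso.refl _⟩⟩, hA⟩,
      W, M, hS, hasFiniteResolution_zero_iff.2 ⟨W, hW, ⟨Iso.refl _⟩⟩, hM⟩
  | succ n ih =>
    obtain ⟨L, G, hL, hG, hS⟩ := hasFiniteResolution_succ_iff.1 hA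
    obtain ⟨-, Y, X, hS', hY, hX⟩ := ih hL
    -- `E` is both an extension of `X` by `G`, hence Gorenstein projective, and an extension of `A`
    -- by `Y`.
    obtain ⟨E, hE', hE⟩ := hS'.exists_pushout hS
    have hE_gp : GP 𝒳 𝒴 E := hadm.gp_extension hE' hG hX
    obtain ⟨W, M, hW, hM, hSW⟩ := hadm.exists_gp_embedding hproj hE_gp
    -- `Q = W / Y` contains `A = E / Y` with quotient `M = W / E`, and `W` lengthens the resolution
    -- of `Y` by one.
    obtain ⟨Q, hQ, hQ'⟩ := hE.exists_cokernel_comp hSW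
    exact ⟨⟨Y, E, hE, hY.succ exists_isZero_isProjective, hE_gp⟩,
      Q, M, hQ', hasFiniteResolution_succ_iff.2 ⟨Y, W, hY, hW, hQ⟩, hM⟩

end IsGPAdmissible

end Cotorsion

end RelGor

/-! ### The cotorsion pair -/

theorem proposition3p13 {C : Type u} [Category.{v} C] [Abelian C] [HasExt.{w} C]
    (𝒳 𝒴 : ObjectProperty C) (hadm : RelGor.IsGPAdmissible.{w} 𝒳 𝒴)
    (hproj : 𝒳 ⊓ 𝒴 = isProjective C)
    (n : ℕ) (hn : RelGor.glGPD 𝒳 𝒴 ≤ (n : ℕ∞)) :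
    RelGor.IsCotorsionPair.{w} (RelGor.GP 𝒳 𝒴) (RelGor.resdimLE (isProjective C) n) ∧
      RelGor.ExtOrthogonal.{w} (RelGor.GP 𝒳 𝒴) (RelGor.resdimLE (isProjective C) n) ∧
      RelGor.IsCompletePair (RelGor.GP 𝒳 𝒴) (RelGor.resdimLE (isProjective C) n) := by
  open RelGor in
  have hle : ∀ N : C, resdimLE (isProjective C) n N ↔ HasFiniteResolution (isProjective C) N n :=
    fun N => resdim_le_iff exists_isZero_isProjective
  have horth : ExtOrthogonal.{w} (GP 𝒳 𝒴) (resdimLE (isProjective C) n) :=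
    fun X Y hX hY => (hadm.extOrthogonal_gp_isProjective hproj).hasFiniteResolution hX ((hle Y).1 hY)
  have happrox : ∀ A : C, (∃ Y X, HasShortExact Y X A ∧ resdimLE (isProjective C) n Y ∧ GP 𝒳 𝒴 X) ∧
      ∃ Y X, HasShortExact A Y X ∧ resdimLE (isProjective C) n Y ∧ GP 𝒳 𝒴 X := fun A => by
    simp only [hle]
    -- The Gorenstein projective resolution keeps its length `m ≤ n`; only the projective ones are
    -- padded to `n`.
    obtain ⟨m, hm, hA⟩ := exists_hasFiniteResolution_of_resdim_le
      ((le_iSup (fun M : C => Gpd 𝒳 𝒴 M) A).trans hn)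
    obtain ⟨⟨Y, X, hS, hY, hX⟩, Y', X', hS', hY', hX'⟩ := hadm.exists_approximations hproj hA
    exact ⟨⟨Y, X, hS, hY.mono exists_isZero_isProjective hm, hX⟩,
      Y', X', hS', hY'.mono exists_isZero_isProjective hm, hX'⟩
  refine ⟨⟨?_, ?_⟩, horth, ⟨fun A => ?_, fun A => ?_⟩⟩
  · ext N
    refine ⟨fun hN => ?_, fun hN X hX => horth hX hN 1 one_pos⟩
    obtain ⟨-, Y, X, hS, hY, hX⟩ := happrox N
    -- `Ext¹(X, N) = 0` splits the sequence, so `N` is a retract of `Y`.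
    obtain ⟨e⟩ := hS.nonempty_iso_biprod (hN hX)
    rw [hle] at hY ⊢
    exact hY.of_retract ⟨biprod.inl ≫ e.inv, e.hom ≫ biprod.fst, by simp⟩
  · ext M
    refine ⟨fun hM Y hY => horth hM hY 1 one_pos, fun hM => ?_⟩
    obtain ⟨⟨Y, X, hS, hY, hX⟩, -⟩ := happrox M
    -- `Ext¹(M, Y) = 0` splits the sequence, so `M` is a summand of `X`.
    obtain ⟨e⟩ := hS.nonempty_iso_biprod (hM hY)
    exact hadm.gp_of_biprod (hX.of_iso (e ≪≫ biprod.braiding _ _))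
  · obtain ⟨⟨Y, X, ⟨f, g, h, hS⟩, hY, hX⟩, -⟩ := happrox A
    exact ⟨Y, X, f, g, h, hS, hY, hX⟩
  · obtain ⟨-, Y, X, ⟨f, g, h, hS⟩, hY, hX⟩ := happrox A
    exact ⟨Y, X, f, g, h, hS, hY, hX⟩
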